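/- Let $d\ge 1$ and let $\mu_1,\dots,\mu_d$ be Borel probability measures on $\mathbb{R}^d$ such that there exist $p_1,\dots,p_d\in(1,+\infty)$ with $$\sum_{i=1}^d \frac1{p_i}=1,\qquad \sum_{i=1}^d\int_{\mathbb{R}^d}\frac{|x|^{p_i}}{p_i}\,d\mu_i(x)<+\infty$$ (this forces $d\ge 2$). Let $\Pi(\mu_1,\dots,\mu_d)$ be the set of Borel probability measures on $(\mathbb{R}^d)^d$ whose $i$-th marginal is $\mu_i$ for every $i$, and let $\gamma\in\Pi(\mu_1,\dots,\mu_d)$. For $y_1,\dots,y_{d-1}\in\mathbb{R}^d$ let $y_1\wedge\dots\wedge y_{d-1}\in\mathbb{R}^d$ be the vector determined by $\langle x,\,y_1\wedge\dots\wedge y_{d-1}\rangle=\det(x,y_1,\dots,y_{d-1})$ for all $x\in\mathbb{R}^d$, and let $\bigwedge_{j\ne i}x_j$ be the product of the $d-1$ vectors $x_j$, $j\neq i$, taken in increasing order of $j$. For $f:\mathbb{R}^d\to\mathbb{R}\cup\{+\infty\}$ let $f^*(y)=\sup_{x}\{\langle x,y\rangle-f(x)\}$ and $\partial f(x)=\{y: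 f(z)\ge f(x)+\langle y,z-x\rangle\ \ \forall z\in\mathbb{R}^d\}$. Then $\gamma$ solves $$(\mathcal{MK})\qquad \sup_{\gamma'\in\Pi(\mu_1,\dots,\mu_d)}\int_{(\mathbb{R}^d)^d}\det(x_1,\dots,x_d)\,d\gamma'(x_1,\dots,x_d)$$ if and only if there exist lower semicontinuous convex functions $\varphi_1,\dots,\varphi_d:\mathbb{R}^d\to\mathbb{R}\cup\{+\infty\}$ such that for all $i\in\{1,\dots,d\}$: 1. $\displaystyle\sum_{j\ne i}\varphi_j(x_j)\ \ge\ \varphi_i^*\Big((-1)^{i+1}\bigwedge_{j\ne i}x_j\Big)$ for all $(x_1,\dots,x_d)\in(\mathbb{R}^d)^d$; 2. $\displaystyle\sum_{j\ne i}\varphi_j(x_j)= \varphi_i^*\Big((-1)^{i+1}\bigwedge_{j\ne i}x_j\Big)$ for $\gamma$-a.e. $(x_1,\dots,x_d)$; 3. $\displaystyle(-1)^{i+1}\bigwedge_{j\ne i}x_j\in\partial\varphi_i(x_i)$ for $\gamma$-a.e. $(x_1,\dots,x_d)$. -/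

import Mathlib

open MeasureTheory

noncomputable section

namespace DetTransport

/-- The Euclidean space `ℝ^d`. -/
abbrev E (d : ℕ) : Type := EuclideanSpace ℝ (Fin d)

/-- `det(x₁, …, x_d)` : the determinant of the matrix whose `i`-th column is `x_i`. -/
def detVec {d : ℕ} (x : Fin d → E d) : ℝ :=
  Matrix.det (Matrix.of fun k i => x i k)

/-- The wedge (generalized cross) product `y₁ ∧ ⋯ ∧ y_{d-1}` of `d - 1 = n` vectors of `ℝ^d`, that is
the vector with `⟨x, y₁ ∧ ⋯ ∧ y_{d-1}⟩ = det(x, y₁, …, y_{d-1})` for all `x`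
(see `inner_wedge`); its `k`-th coordinate is `det(e_k, y₁, …, y_{d-1})`. -/
def wedge {n : ℕ} (y : Fin n → E (n + 1)) : E (n + 1) :=
  WithLp.toLp 2 fun k =>
    detVec (Fin.cons (EuclideanSpace.single k (1 : ℝ)) y : Fin (n + 1) → E (n + 1))

/-- The vector `(-1)^{i+1} ⋀_{j ≠ i} x_j`, where `i ∈ {1, …, d}` and the `x_j`, `j ≠ i`, are taken in
increasing order of `j`. Since `Fin (n + 1)` counts from `0`, the exponent `i + 1` of the
one-based index is `(i : ℕ) + 2` here. -/
def signedWedge {n : ℕ} (i : Fin (n + 1)) (x : Fin (n + 1) → E (n + 1)) : E (n + 1) :=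
  (-1 : ℝ) ^ ((i : ℕ) + 2) • wedge fun j => x (i.succAbove j)

/-- The set `Π(μ₁, …, μ_d)` of probability measures on `(ℝ^d)^d` with marginals `μ_i`. -/
def couplings {d : ℕ} (μ : Fin d → Measure (E d)) : Set (Measure (Fin d → E d)) :=
  {γ | IsProbabilityMeasure γ ∧ ∀ i, γ.map (fun x => x i) = μ i}

/-- The integrability assumption on the marginals: there are `p_i ∈ (1, ∞)` with `∑ 1 / p_i = 1`
and `∑ ∫ |x|^{p_i} / p_i dμ_i < ∞`. (It forces `d ≥ 2`.) -/
def MomentCondition {d : ℕ} (μ : Fin d → Measure (E d)) : Prop :=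
  ∃ p : Fin d → ℝ, (∀ i, 1 < p i) ∧ ∑ i, 1 / p i = 1 ∧
    ∑ i, ∫⁻ x, ENNReal.ofReal (‖x‖ ^ p i / p i) ∂μ i < ⊤

/-- `γ` solves `sup_{γ ∈ Π(μ₁, …, μ_d)} ∫ det(x₁, …, x_d) dγ`. (Under `MomentCondition μ`, `det` is
integrable for every coupling, because `|det x| ≤ ∏ |x_i| ≤ ∑ |x_i|^{p_i} / p_i`.) -/
def SolvesMK {d : ℕ} (μ : Fin d → Measure (E d)) (γ : Measure (Fin d → E d)) : Prop :=
  γ ∈ couplings μ ∧ IsMaxOn (fun γ' => ∫ x, detVec x ∂γ') (couplings μ) γ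

/-- Convexity of an extended-real-valued function. -/
def ConvexE {d : ℕ} (f : E d → EReal) : Prop :=
  ∀ x y : E d, ∀ a b : ℝ, 0 < a → 0 < b → a + b = 1 →
    f (a • x + b • y) ≤ (a : EReal) * f x + (b : EReal) * f y

/-- The Legendre–Fenchel conjugate `f^*(y) = sup_x (⟨x, y⟩ - f(x))`. -/
def conj {d : ℕ} (f : E d → EReal) (y : E d) : EReal :=
  ⨆ x : E d, ((inner ℝ x y : ℝ) : EReal) - f x

/-- The subdifferential `∂f(x) = {y | f(z) ≥ f(x) + ⟨y, z - x⟩ for all z}`. -/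
def subdiff {d : ℕ} (f : E d → EReal) (x : E d) : Set (E d) :=
  {y | ∀ z : E d, f x + ((inner ℝ y (z - x) : ℝ) : EReal) ≤ f z}

theorem inner_wedge {n : ℕ} (x : E (n + 1)) (y : Fin n → E (n + 1)) :
    inner ℝ x (wedge y) = detVec (Fin.cons x y : Fin (n + 1) → E (n + 1)) := by
  have key : ∀ v : E (n + 1), detVec (Fin.cons v y : Fin (n + 1) → E (n + 1)) =
      ∑ k : Fin (n + 1), v k *
        ((-1) ^ (k : ℕ) * Matrix.det (Matrix.of fun (a b : Fin n) => y b (k.succAbove a))) := by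
    intro v
    unfold detVec
    rw [Matrix.det_succ_column_zero]
    refine Finset.sum_congr rfl fun k _ => ?_
    simp only [Matrix.of_apply, Fin.cons_zero]
    rw [mul_comm ((-1 : ℝ) ^ (k : ℕ)), mul_assoc]
    rfl
  simp only [PiLp.inner_apply, wedge]
  rw [key x]
  refine Finset.sum_congr rfl fun k _ => ?_
  rw [key]
  simp [mul_comm]

theorem inner_signedWedge {n : ℕ} (i : Fin (n + 1)) (x : Fin (n + 1) → E (n + 1)) :
    inner ℝ (x i) (signedWedge i x) = detVec x := by
  rw [signedWedge, inner_smul_right, inner_wedge]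
  unfold detVec
  rw [Matrix.det_succ_column_zero, Matrix.det_succ_column _ i, Finset.mul_sum]
  refine Finset.sum_congr rfl fun k _ => ?_
  simp only [Matrix.of_apply, Fin.cons_zero]
  rw [pow_add, pow_add]
  have : (Matrix.of fun k' j => (Fin.cons (x i) (fun j => x (i.succAbove j)) :
      Fin (n + 1) → E (n + 1)) j k').submatrix k.succAbove Fin.succ =
      (Matrix.of fun k' j => x j k').submatrix k.succAbove i.succAbove := rfl
  rw [this]
  ring

end DetTransport

end

/-! Since `signedWedge i x` does not involve `x i` and pairs with it to `detVec x`, condition 1 for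
any single index is equivalent to `detVec x ≤ ∑ j, φ j (x j)` everywhere (`forall_conj_le_iff`).
Given this, conditions 2 and 3 amount to equality γ-a.e. The theorem is thus complementary slackness
for multi-marginal transport.

Sufficiency (`solvesMK_of_potential`) integrates the inequality against a competitor and the
equality against γ. The potentials need not be integrable, so affine minorants, supplied by
subgradients at one good point, are subtracted before integrating.

Necessity builds potentials from the support of γ. Rearranging small pieces of γ shows that
optimality passes to finitely supported problems on the support (`sum_mul_le_of_mem_support`).
Separation of convex sets gives almost optimal potentials there (`exists_potential_lt_add`), and
compactness makes them exact on the whole support (`exists_potential_of_finite`). Extended by `⊤`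
and biconjugated, they become convex and lower semicontinuous, with the inequality preserved
everywhere and the equality on the support. -/

noncomputable section

namespace DetTransport

open Filter Topology

/-! ### Finite linear programming duality by separation -/

section Potentials

variable {ι κ : Type*} [Fintype ι] [DecidableEq ι]

/-- Duality, up to `ε`, for the multi-marginal linear program on a finite grid: if the diagonal
cannot be improved by weights on the grid with the same marginals, there are almost optimal
potentials. -/
theorem exists_potential_lt_add [Fintype κ] [DecidableEq κ] (c : (ι → κ) → ℝ)
    (h : ∀ (α : (ι → κ) → ℝ) (β : κ → ℝ), (∀ s, 0 ≤ α s) → (∀ k, 0 ≤ β k) →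
      (∀ i k, ∑ s, (if s i = k then α s else 0) = β k) →
      ∑ s, α s * c s ≤ ∑ k, β k * c fun _ => k) {ε : ℝ} (hε : 0 < ε) :
    ∃ φ : ι → κ → ℝ, (∀ s, c s - ε < ∑ i, φ i (s i)) ∧
      ∀ k, ∑ i, φ i k < c (fun _ => k) + ε := by
  by_contra hcon
  let A : (ι → κ → ℝ) → ((ι → κ) ⊕ κ) → ℝ := fun φ =>
    Sum.elim (fun s => ∑ i, φ i (s i)) (fun k => -∑ i, φ i k)
  have hA_add (φ ψ) (r) : A (φ + ψ) r = A φ r + A ψ r := by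
    cases r <;> simp [A, Finset.sum_add_distrib, add_comm]
  have hA_smul (t : ℝ) (φ) (r) : A (t • φ) r = t * A φ r := by
    cases r <;> simp [A, Finset.mul_sum]
  let b : ((ι → κ) ⊕ κ) → ℝ := Sum.elim c fun k => -c fun _ => k
  -- `D` collects the vectors strictly dominated by the range of `A`; by `hcon` it misses `b - ε`.
  let D : Set (((ι → κ) ⊕ κ) → ℝ) := ⋃ φ, {v | ∀ r, v r < A φ r}
  have hD_open : IsOpen D := isOpen_iUnion fun φ => by
    simp only [Set.ofPred_forall]
    exact isOpen_iInter_of_finite fun r => isOpen_lt (by fun_prop) (by fun_prop)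
  have hmemD {v} : v ∈ D ↔ ∃ φ, ∀ r, v r < A φ r := by simp [D]
  have hD_convex : Convex ℝ D := by
    intro v hv w hw a a' ha ha' haa
    obtain ⟨φ, hφ⟩ := hmemD.1 hv
    obtain ⟨ψ, hψ⟩ := hmemD.1 hw
    refine hmemD.2 ⟨a • φ + a' • ψ, fun r => ?_⟩
    rw [hA_add, hA_smul, hA_smul]
    simp only [Pi.add_apply, Pi.smul_apply, smul_eq_mul]
    rcases ha.eq_or_lt with rfl | ha
    · have : a' = 1 := by linarith
      subst this
      linarith [hψ r]
    · have := mul_lt_mul_of_pos_left (hφ r) ha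
      have := mul_le_mul_of_nonneg_left (hψ r).le ha'
      linarith
  have hb : (fun r => b r - ε) ∉ D := by
    intro hbD
    obtain ⟨φ, hφ⟩ := hmemD.1 hbD
    refine hcon ⟨φ, fun s => hφ (Sum.inl s), fun k => ?_⟩
    have := hφ (Sum.inr k)
    simp only [b, A, Sum.elim_inr] at this
    linarith
  obtain ⟨f, hf⟩ := geometric_hahn_banach_open_point hD_convex hD_open hb
  let y : ((ι → κ) ⊕ κ) → ℝ := fun r => f (Pi.single r 1)
  have hfy (v : ((ι → κ) ⊕ κ) → ℝ) : f v = ∑ r, v r * y r := by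
    have := LinearMap.pi_apply_eq_sum_univ (f : (((ι → κ) ⊕ κ) → ℝ) →ₗ[ℝ] ℝ) v
    simp only [ContinuousLinearMap.coe_coe, smul_eq_mul] at this
    rw [this]
    refine Finset.sum_congr rfl fun r _ => ?_
    congr 2
    ext r'
    simp [Pi.single_apply, eq_comm]
  -- `D` recedes in every direction dominated by the range of `A`, and `f` is bounded above on `D`.
  -- Hence `y ≥ 0`, and `f` vanishes on the range of `A`, which is the marginal constraint on the
  -- weights.
  have hdir (u : ((ι → κ) ⊕ κ) → ℝ) (hu : ∃ φ, ∀ r, u r ≤ A φ r) : f u ≤ 0 := by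
    obtain ⟨φ, hφ⟩ := hu
    by_contra! hpos
    have key (t : ℝ) (ht : 0 ≤ t) : t * f u + f (fun _ => -1) < f fun r => b r - ε := by
      have := hf (t • u + fun _ => -1) (hmemD.2 ⟨t • φ, fun r => by
        rw [hA_smul]
        simp only [Pi.add_apply, Pi.smul_apply, smul_eq_mul]
        linarith [mul_le_mul_of_nonneg_left (hφ r) ht]⟩)
      rwa [map_add, map_smul, smul_eq_mul] at this
    set C := (f fun r => b r - ε) - f (fun _ => -1)
    have h0 : 0 < C := by linarith [key 0 le_rfl]
    have h1 := key (C / f u) (by positivity)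
    rw [div_mul_cancel₀ _ hpos.ne'] at h1
    simp only [C] at h1
    linarith
  have hy (r) : 0 ≤ y r := by
    have := hdir (-Pi.single r 1) ⟨0, fun r' => by
      have hA0 : A 0 r' = 0 := by cases r' <;> simp [A]
      rw [hA0, Pi.neg_apply, Pi.single_apply]
      split_ifs <;> simp⟩
    rw [map_neg] at this
    linarith
  have hmarg (i : ι) (k : κ) :
      ∑ s : ι → κ, (if s i = k then y (Sum.inl s) else 0) = y (Sum.inr k) := by
    have hz : f (A (Pi.single i (Pi.single k 1))) = 0 := by
      refine le_antisymm (hdir _ ⟨_, fun r => le_rfl⟩) ?_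
      have := hdir (-A (Pi.single i (Pi.single k 1))) ⟨(-1 : ℝ) • Pi.single i (Pi.single k 1),
        fun r => by rw [hA_smul]; simp⟩
      rw [map_neg] at this
      linarith
    have hsum (g : ι → κ) : ∑ j, (Pi.single i (Pi.single k (1 : ℝ)) : ι → κ → ℝ) j (g j) =
        if g i = k then 1 else 0 := by
      rw [Finset.sum_eq_single i (fun j _ hj => by simp [hj]) (by simp)]
      simp [Pi.single_apply]
    rw [hfy, Fintype.sum_sum_type] at hz
    simp only [A, Sum.elim_inl, Sum.elim_inr, hsum, ite_mul, one_mul, zero_mul, neg_mul,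
      Finset.sum_neg_distrib, Finset.sum_ite_eq', Finset.mem_univ, if_true] at hz
    linarith
  have hle := h (fun s => y (Sum.inl s)) (fun k => y (Sum.inr k)) (fun s => hy _) (fun k => hy _)
    hmarg
  have hfb : f b ≤ 0 := by
    rw [hfy, Fintype.sum_sum_type]
    simp only [b, Sum.elim_inl, Sum.elim_inr, neg_mul, Finset.sum_neg_distrib]
    simp only [mul_comm] at hle ⊢
    linarith
  -- The constant `-ε` lies in `D`, so separation gives `f (-ε) < f b + f (-ε)`, against `f b ≤ 0`.
  have hlt := hf (fun _ => -ε) (hmemD.2 ⟨0, fun r => by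
    have hA0 : A 0 r = 0 := by cases r <;> simp [A]
    rw [hA0]
    linarith⟩)
  have : (fun r => b r - ε) = b + fun _ => -ε := by
    ext r; simp [sub_eq_add_neg]
  rw [this, map_add] at hlt
  linarith

end Potentials

/-! ### Normalization and compactness of potentials -/

section Potentials

variable {ι κ : Type*} [Fintype ι] [DecidableEq ι]

/-- Potentials that are almost optimal on a finite set can be normalized so as to obey bounds that
depend neither on the finite set nor on `ε ≤ 1`. -/
theorem exists_potential_bounded [Nonempty ι] (c : (ι → κ) → ℝ) (x₀ : κ) (G : Set κ)
    (hx₀ : x₀ ∈ G) {ε : ℝ} (hε : ε ≤ 1)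
    (h : ∃ φ : ι → κ → ℝ, (∀ s, (∀ i, s i ∈ G) → c s - ε ≤ ∑ i, φ i (s i)) ∧
      ∀ k ∈ G, ∑ i, φ i k ≤ c (fun _ => k) + ε) :
    ∃ φ : ι → κ → ℝ, ((∀ s, (∀ i, s i ∈ G) → c s - ε ≤ ∑ i, φ i (s i)) ∧
      ∀ k ∈ G, ∑ i, φ i k ≤ c (fun _ => k) + ε) ∧
      ∀ i, ∀ k ∈ G,
        c (Function.update (fun _ => x₀) i k) - 2 - |c fun _ => x₀| ≤ φ i k := by
  obtain ⟨φ, h1, h2⟩ := h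
  set S := ∑ i, φ i x₀ with hS
  set d : ℝ := (Fintype.card ι : ℝ) with hd
  have hd1 : 1 ≤ d := by
    rw [hd]; exact_mod_cast Fintype.card_pos
  have hsum (s : ι → κ) : ∑ i, (φ i (s i) - φ i x₀ + S / d) = ∑ i, φ i (s i) := by
    rw [Finset.sum_add_distrib, Finset.sum_sub_distrib, ← hS, Finset.sum_const, Finset.card_univ,
      nsmul_eq_mul, ← hd]
    field_simp
    ring
  -- The added constants sum to zero over `i`; they give all potentials the same value `S / d` at
  -- `x₀`.
  refine ⟨fun i k => φ i k - φ i x₀ + S / d, ⟨fun s hs => ?_, fun k hk => ?_⟩, fun i k hk => ?_⟩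
  · rw [hsum]; exact h1 s hs
  · rw [hsum fun _ => k]; exact h2 k hk
  · have hSle := h2 x₀ hx₀
    have hSge := h1 (fun _ => x₀) fun _ => hx₀
    rw [← hS] at hSle hSge
    have h3 := h1 (Function.update (fun _ => x₀) i k) fun j => by
      rcases eq_or_ne j i with rfl | hj
      · simpa using hk
      · simpa [hj] using hx₀
    have h4 : ∑ j, φ j (Function.update (fun _ => x₀) i k j) = φ i k - φ i x₀ + S := by
      rw [hS, ← Finset.add_sum_erase _ _ (Finset.mem_univ i),
        ← Finset.add_sum_erase Finset.univ (fun j => φ j x₀) (Finset.mem_univ i)]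
      have : ∑ j ∈ Finset.univ.erase i, φ j (Function.update (fun _ => x₀) i k j) =
          ∑ j ∈ Finset.univ.erase i, φ j x₀ :=
        Finset.sum_congr rfl fun j hj => by simp [Finset.ne_of_mem_erase hj]
      rw [this]
      simp only [Function.update_self]
      ring
    have h5 : S - S / d ≤ |c fun _ => x₀| + 1 := by
      have h6 : S - S / d = S * (1 - 1 / d) := by ring
      have h7 : 0 ≤ 1 - 1 / d := by
        rw [sub_nonneg, div_le_one (by linarith)]; exact hd1
      have h8 : 1 - 1 / d ≤ 1 := by
        have : 0 ≤ 1 / d := by positivity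
        linarith
      have h9 : S ≤ |c fun _ => x₀| + 1 := by linarith [le_abs_self (c fun _ => x₀)]
      rw [h6]
      calc S * (1 - 1 / d) ≤ (|c fun _ => x₀| + 1) * (1 - 1 / d) := by gcongr
        _ ≤ (|c fun _ => x₀| + 1) * 1 := by gcongr
        _ = _ := mul_one _
    linarith

/-- Existence of exact potentials from almost optimal potentials on finite sets, by compactness. -/
theorem exists_potential_of_finite [Nonempty ι] (c : (ι → κ) → ℝ)
    (h : ∀ (G : Finset κ) (ε : ℝ), 0 < ε →
      ∃ φ : ι → κ → ℝ, (∀ s, (∀ i, s i ∈ G) → c s - ε ≤ ∑ i, φ i (s i)) ∧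
        ∀ k ∈ G, ∑ i, φ i k ≤ c (fun _ => k) + ε) :
    ∃ φ : ι → κ → ℝ, (∀ s, c s ≤ ∑ i, φ i (s i)) ∧ ∀ k, ∑ i, φ i k = c fun _ => k := by
  classical
  rcases isEmpty_or_nonempty κ with hκ | ⟨⟨x₀⟩⟩
  · exact ⟨fun _ _ => 0, fun s => (hκ.false (s (Classical.arbitrary ι))).elim,
      fun k => (hκ.false k).elim⟩
  have hε (N : ℕ) : 1 / ((N : ℝ) + 1) ≤ 1 := by
    rw [div_le_one (by positivity)]; linarith [(N.cast_nonneg : (0 : ℝ) ≤ N)]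
  have hex (p : Finset κ × ℕ) := exists_potential_bounded c x₀ (↑(insert x₀ p.1) : Set κ)
    (by simp) (hε p.2) (h (insert x₀ p.1) _ (by positivity))
  choose ψ hψ hψL using hex
  -- The index records a finite set and an `N` standing for `ε = 1 / (N + 1)`; along `U` the sets
  -- exhaust `κ` and `ε` tends to zero.
  let U : Ultrafilter (Finset κ × ℕ) := Ultrafilter.of atTop
  have hU : (U : Filter (Finset κ × ℕ)) ≤ atTop := Ultrafilter.of_le atTop
  have hmem (G : Finset κ) : ∀ᶠ p in (U : Filter (Finset κ × ℕ)), G ⊆ insert x₀ p.1 := by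
    refine hU ?_
    filter_upwards [eventually_ge_atTop ((G, 0) : Finset κ × ℕ)] with p hp
    exact hp.1.trans (Finset.subset_insert _ _)
  have hεlim : Tendsto (fun p : Finset κ × ℕ => 1 / ((p.2 : ℝ) + 1)) U (𝓝 0) := by
    refine Tendsto.mono_left ?_ hU
    rw [← prod_atTop_atTop_eq]
    exact tendsto_one_div_add_atTop_nhds_zero_nat.comp tendsto_snd
  have hlim (i : ι) (k : κ) : ∃ a, Tendsto (fun p => ψ p i k) U (𝓝 a) := by
    -- The upper bound comes from the diagonal inequality once the other potentials are bounded
    -- below by `L j`.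
    set L : ι → ℝ := fun j => c (Function.update (fun _ => x₀) j k) - 2 - |c fun _ => x₀|
    have hK : IsCompact (Set.Icc (L i) (c (fun _ => k) + 1 - ∑ j ∈ Finset.univ.erase i, L j)) :=
      isCompact_Icc
    obtain ⟨a, -, ha⟩ := hK.ultrafilter_le_nhds (U.map fun p => ψ p i k) (by
      rw [le_principal_iff]
      change ∀ᶠ p in (U : Filter (Finset κ × ℕ)), ψ p i k ∈ _
      filter_upwards [hmem {k}] with p hp
      have hk : k ∈ insert x₀ p.1 := hp (by simp)
      refine ⟨hψL p i k hk, ?_⟩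
      have h1 := (hψ p).2 k hk
      rw [← Finset.add_sum_erase _ _ (Finset.mem_univ i)] at h1
      have h2 : ∑ j ∈ Finset.univ.erase i, L j ≤ ∑ j ∈ Finset.univ.erase i, ψ p j k :=
        Finset.sum_le_sum fun j _ => hψL p j k hk
      linarith [hε p.2])
    exact ⟨a, ha⟩
  choose φ hφ using hlim
  have hlow (s : ι → κ) : c s ≤ ∑ i, φ i (s i) := by
    have h1 : Tendsto (fun p : Finset κ × ℕ => ∑ i, ψ p i (s i) + 1 / ((p.2 : ℝ) + 1)) U
        (𝓝 (∑ i, φ i (s i) + 0)) :=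
      (tendsto_finsetSum _ fun i _ => hφ i (s i)).add hεlim
    rw [add_zero] at h1
    refine ge_of_tendsto h1 ?_
    filter_upwards [hmem (Finset.univ.image s)] with p hp
    linarith [(hψ p).1 s fun i => hp (Finset.mem_image_of_mem _ (Finset.mem_univ i))]
  refine ⟨φ, hlow, fun k => le_antisymm ?_ (hlow _)⟩
  have h1 : Tendsto (fun p : Finset κ × ℕ => ∑ i, ψ p i k - 1 / ((p.2 : ℝ) + 1)) U
      (𝓝 (∑ i, φ i k - 0)) :=
    (tendsto_finsetSum _ fun i _ => hφ i k).sub hεlim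
  rw [sub_zero] at h1
  refine le_of_tendsto h1 ?_
  filter_upwards [hmem {k}] with p hp
  linarith [(hψ p).2 k (hp (by simp))]

end Potentials

/-! ### Optimality passes to finite subsets of the support -/

section Perturbation

variable {ι κ X : Type*} [Fintype ι] [DecidableEq ι] [Fintype κ] [DecidableEq κ]
  [PseudoMetricSpace X] [SecondCountableTopology X] [MeasurableSpace X] [BorelSpace X]

/-- Multi-marginal cyclical monotonicity of the support of an optimal coupling for a continuous
payoff. -/
theorem sum_mul_le_of_mem_support {c : (ι → X) → ℝ} (hc : Continuous c) {γ : Measure (ι → X)}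
    [IsFiniteMeasure γ] (hint : Integrable c γ)
    (hopt : ∀ γ' : Measure (ι → X), (∀ i, γ'.map (fun x => x i) = γ.map fun x => x i) →
      ∫ x, c x ∂γ' ≤ ∫ x, c x ∂γ)
    (x : κ → ι → X) (hx : ∀ k, x k ∈ γ.support) (α : (ι → κ) → ℝ) (β : κ → ℝ)
    (hα : ∀ s, 0 ≤ α s) (hβ : ∀ k, 0 ≤ β k)
    (hαβ : ∀ i k, ∑ s, (if s i = k then α s else 0) = β k) :
    ∑ s, α s * c (fun i => x (s i) i) ≤ ∑ k, β k * c (x k) := by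
  refine le_of_forall_pos_le_add fun η₀ hη₀ => ?_
  set T := ∑ s, α s + ∑ k, β k with hT
  have hT0 : 0 ≤ T := add_nonneg (Finset.sum_nonneg fun s _ => hα s)
    (Finset.sum_nonneg fun k _ => hβ k)
  obtain ⟨η, hη, hηT⟩ : ∃ η, 0 < η ∧ η * T ≤ η₀ :=
    ⟨η₀ / (T + 1), by positivity, by
      rw [div_mul_eq_mul_div, div_le_iff₀ (by positivity)]; nlinarith⟩
  have hr : ∃ r > 0, ∀ s : ι → κ, ∀ z : ι → X, (∀ i, z i ∈ Metric.ball (x (s i) i) r) →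
      |c z - c fun i => x (s i) i| ≤ η := by
    have (s : ι → κ) : ∀ᶠ r in 𝓝[>] (0 : ℝ), ∀ z : ι → X,
        (∀ i, z i ∈ Metric.ball (x (s i) i) r) → |c z - c fun i => x (s i) i| ≤ η := by
      obtain ⟨δ, hδ, h⟩ := Metric.continuousAt_iff.1 (hc.continuousAt (x := fun i => x (s i) i)) η hη
      filter_upwards [Ioo_mem_nhdsGT hδ] with r hr z hz
      have : dist z (fun i => x (s i) i) < δ :=
        (dist_pi_lt_iff hδ).2 fun i => (Metric.mem_ball.1 (hz i)).trans hr.2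
      have := h this
      rw [Real.dist_eq] at this
      exact this.le
    obtain ⟨r, h, hr⟩ := ((eventually_all.2 this).and self_mem_nhdsWithin).exists
    exact ⟨r, hr, h⟩
  obtain ⟨r, hr0, hr⟩ := hr
  set V : κ → Set (ι → X) := fun k => Metric.ball (x k) r with hV
  have hVpos (k) : γ (V k) ≠ 0 :=
    ((γ.mem_support_iff_forall _).1 (hx k) _ (Metric.ball_mem_nhds _ hr0)).ne'
  have hVm (k) : MeasurableSet (V k) := Metric.isOpen_ball.measurableSet
  set g : κ → Measure (ι → X) := fun k => (γ (V k))⁻¹ • γ.restrict (V k) with hg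
  have hgp (k) : IsProbabilityMeasure (g k) := ⟨by
    simp only [hg, Measure.smul_apply, smul_eq_mul, Measure.restrict_apply_univ]
    exact ENNReal.inv_mul_cancel (hVpos k) (measure_ne_top _ _)⟩
  have hgV (k) : ∀ᵐ z ∂g k, z ∈ V k :=
    Measure.ae_smul_measure (ae_restrict_mem (hVm k)) _
  set m : κ → ι → Measure X := fun k i => (g k).map fun z => z i with hm
  have hmp (k i) : IsProbabilityMeasure (m k i) :=
    Measure.isProbabilityMeasure_map (measurable_pi_apply i).aemeasurable
  have hmV (k i) : ∀ᵐ z ∂m k i, z ∈ Metric.ball (x k i) r := by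
    have hmi : Measurable fun z : ι → X => z i := measurable_pi_apply i
    have hball : MeasurableSet {z | z ∈ Metric.ball (x k i) r} := Metric.isOpen_ball.measurableSet
    refine (ae_map_iff hmi.aemeasurable hball).2 ?_
    filter_upwards [hgV k] with z hz
    exact (dist_le_pi_dist z (x k) i).trans_lt hz
  -- `π s` couples the marginals of normalized pieces of γ near the points `x (s i)`, so it lives
  -- near the recombined point `fun i => x (s i) i`.
  set π : (ι → κ) → Measure (ι → X) := fun s => Measure.pi fun i => m (s i) i with hπ
  have hπV (s) : ∀ᵐ z ∂π s, ∀ i, z i ∈ Metric.ball (x (s i) i) r :=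
    ae_all_iff.2 fun i => (Measure.quasiMeasurePreserving_eval
      (μ := fun i => m (s i) i) i).ae (hmV (s i) i)
  have hπmap (s i) : (π s).map (fun z => z i) = m (s i) i := by
    have := Measure.pi_map_eval (μ := fun i => m (s i) i) i
    simp only [measure_univ, Finset.prod_const_one, one_smul] at this
    exact this
  have hcg (k) : ∀ᵐ z ∂g k, |c z - c (x k)| ≤ η := by
    filter_upwards [hgV k] with z hz
    exact hr (fun _ => k) z fun i => (dist_le_pi_dist z (x k) i).trans_lt hz
  have hcπ (s) : ∀ᵐ z ∂π s, |c z - c fun i => x (s i) i| ≤ η := by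
    filter_upwards [hπV s] with z hz
    exact hr s z hz
  have hint_of {ρ : Measure (ι → X)} [IsProbabilityMeasure ρ] {a : ℝ}
      (h : ∀ᵐ z ∂ρ, |c z - a| ≤ η) : Integrable c ρ ∧ |∫ z, c z ∂ρ - a| ≤ η := by
    have h1 : Integrable (fun z => c z - a) ρ :=
      Integrable.of_bound (hc.sub continuous_const).aestronglyMeasurable η h
    have h2 : Integrable c ρ := by
      refine (h1.add (integrable_const a)).congr (.of_forall fun z => ?_)
      simp
    refine ⟨h2, ?_⟩
    have h3 := norm_integral_le_of_norm_le_const (f := fun z => c z - a) h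
    rw [integral_sub h2 (integrable_const a)] at h3
    simpa using h3
  -- `g k ≤ (γ (V k))⁻¹ • γ`, so this smallness yields `ν ≤ γ`, and `γ - ν + ν'` is a genuine
  -- measure.
  obtain ⟨ε, hε, hε1⟩ : ∃ ε : ℝ, 0 < ε ∧
      ∑ k, ENNReal.ofReal (ε * β k) * (γ (V k))⁻¹ ≤ 1 := by
    set Q := ∑ k, ENNReal.ofReal (β k) * (γ (V k))⁻¹
    have hQ : Q ≠ ⊤ := ENNReal.sum_ne_top.2 fun k _ =>
      ENNReal.mul_ne_top ENNReal.ofReal_ne_top (ENNReal.inv_ne_top.2 (hVpos k))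
    refine ⟨1 / (Q.toReal + 1), by positivity, ?_⟩
    simp_rw [ENNReal.ofReal_mul (by positivity : (0 : ℝ) ≤ 1 / (Q.toReal + 1)), mul_assoc]
    rw [← Finset.mul_sum]
    change _ * Q ≤ 1
    rw [← ENNReal.ofReal_toReal hQ, ← ENNReal.ofReal_mul (by positivity),
      ENNReal.toReal_ofReal ENNReal.toReal_nonneg, ← ENNReal.ofReal_one]
    refine ENNReal.ofReal_le_ofReal ?_
    rw [div_mul_eq_mul_div, div_le_one (by positivity)]
    linarith
  set ν : Measure (ι → X) := ∑ k, ENNReal.ofReal (ε * β k) • g k with hν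
  set ν' : Measure (ι → X) := ∑ s, ENNReal.ofReal (ε * α s) • π s with hν'
  have hνγ : ν ≤ γ := by
    refine Measure.le_iff.2 fun B _ => ?_
    have : ν B ≤ ∑ k, ENNReal.ofReal (ε * β k) * (γ (V k))⁻¹ * γ B := by
      simp only [hν, hg, Measure.coe_finsetSum, Finset.sum_apply, Measure.smul_apply, smul_eq_mul,
        mul_assoc]
      gcongr with k
      exact Measure.restrict_le_self
    refine this.trans ?_
    rw [← Finset.sum_mul]
    exact mul_le_of_le_one_left zero_le hε1
  have : IsFiniteMeasure ν := isFiniteMeasure_of_le γ hνγ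
  have hsplit : γ - ν + ν = γ := Measure.sub_add_cancel_of_le hνγ
  have hνc : Integrable c ν := hint.mono_measure hνγ
  have hρc : Integrable c (γ - ν) := hint.mono_measure Measure.sub_le
  have hν'c : Integrable c ν' := by
    refine integrable_finsetSum_measure.2 fun s _ => ?_
    exact (hint_of (hcπ s)).1.smul_measure ENNReal.ofReal_ne_top
  have hmap (i) : ν'.map (fun z => z i) = ν.map fun z => z i := by
    ext B hB
    have hmi : Measurable fun z : ι → X => z i := measurable_pi_apply i
    rw [Measure.map_apply hmi hB, Measure.map_apply hmi hB]
    have h1 (s) : π s ((fun z => z i) ⁻¹' B) = m (s i) i B := by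
      rw [← hπmap s i, Measure.map_apply hmi hB]
    have h2 (k) : g k ((fun z => z i) ⁻¹' B) = m k i B := by
      rw [hm, Measure.map_apply hmi hB]
    simp only [hν, hν', Measure.coe_finsetSum, Finset.sum_apply, Measure.smul_apply, smul_eq_mul,
      h1, h2]
    have h3 (k) : ENNReal.ofReal (ε * β k) =
        ∑ s, if s i = k then ENNReal.ofReal (ε * α s) else 0 := by
      rw [← hαβ i k, Finset.mul_sum, ENNReal.ofReal_sum_of_nonneg]
      · refine Finset.sum_congr rfl fun s _ => ?_
        split_ifs <;> simp
      · intro s _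
        split_ifs
        · exact mul_nonneg hε.le (hα s)
        · simp
    simp only [h3, Finset.sum_mul, ite_mul, zero_mul]
    rw [Finset.sum_comm]
    simp
  have hle := hopt (γ - ν + ν') fun i => by
    have hmi : Measurable fun z : ι → X => z i := measurable_pi_apply i
    rw [Measure.map_add _ _ hmi, hmap, ← Measure.map_add _ _ hmi, hsplit]
  rw [integral_add_measure hρc hν'c, ← congrArg (fun ρ => ∫ z, c z ∂ρ) hsplit] at hle
  simp only [] at hle
  rw [integral_add_measure hρc hνc] at hle
  have hle' : ∫ z, c z ∂ν' ≤ ∫ z, c z ∂ν := by linarith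
  rw [hν, hν', integral_finsetSum_measure fun s _ =>
      (hint_of (hcπ s)).1.smul_measure ENNReal.ofReal_ne_top,
    integral_finsetSum_measure fun k _ =>
      (hint_of (hcg k)).1.smul_measure ENNReal.ofReal_ne_top] at hle'
  simp only [integral_smul_measure, smul_eq_mul, ENNReal.toReal_ofReal (mul_nonneg hε.le (hα _)),
    ENNReal.toReal_ofReal (mul_nonneg hε.le (hβ _)), mul_assoc, ← Finset.mul_sum] at hle'
  have hle'' := le_of_mul_le_mul_left hle' hε
  have hL : ∑ s, α s * (c (fun i => x (s i) i) - η) ≤ ∑ s, α s * ∫ z, c z ∂π s :=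
    Finset.sum_le_sum fun s _ => mul_le_mul_of_nonneg_left
      (by linarith [(abs_le.1 (hint_of (hcπ s)).2).1]) (hα s)
  have hR : ∑ k, β k * ∫ z, c z ∂g k ≤ ∑ k, β k * (c (x k) + η) :=
    Finset.sum_le_sum fun k _ => mul_le_mul_of_nonneg_left
      (by linarith [(abs_le.1 (hint_of (hcg k)).2).2]) (hβ k)
  simp only [mul_sub, mul_add, Finset.sum_sub_distrib, Finset.sum_add_distrib,
    ← Finset.sum_mul] at hL hR
  have : (∑ s, α s) * η + (∑ k, β k) * η ≤ η₀ := by rw [← add_mul, mul_comm]; exact hηT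
  linarith

end Perturbation

/-! ### Finite sums of extended reals -/

section ExtendedReals

variable {ι : Type*}

theorem coe_finset_sum (s : Finset ι) (f : ι → ℝ) :
    ((∑ i ∈ s, f i : ℝ) : EReal) = ∑ i ∈ s, (f i : EReal) := by
  classical
  induction s using Finset.induction_on with
  | empty => simp
  | insert i s hi ih => rw [Finset.sum_insert hi, Finset.sum_insert hi, EReal.coe_add, ih]

theorem sum_ne_bot {s : Finset ι} {f : ι → EReal} (h : ∀ i ∈ s, f i ≠ ⊥) : ∑ i ∈ s, f i ≠ ⊥ := by
  classical
  induction s using Finset.induction_on with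
  | empty => simp
  | insert i s hi ih =>
    rw [Finset.sum_insert hi, EReal.add_ne_bot_iff]
    exact ⟨h i (by simp), ih fun j hj => h j (by simp [hj])⟩

theorem sum_ne_top {s : Finset ι} {f : ι → EReal} (h : ∀ i ∈ s, f i ≠ ⊤) : ∑ i ∈ s, f i ≠ ⊤ := by
  classical
  induction s using Finset.induction_on with
  | empty => simp
  | insert i s hi ih =>
    rw [Finset.sum_insert hi]
    exact EReal.add_ne_top (h i (by simp)) (ih fun j hj => h j (by simp [hj]))

theorem sum_eq_top [Fintype ι] {f : ι → EReal} (h : ∀ i, f i ≠ ⊥) {i : ι} (hi : f i = ⊤) :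
    ∑ i, f i = ⊤ := by
  classical
  rw [← Finset.add_sum_erase _ _ (Finset.mem_univ i), hi]
  exact EReal.top_add_of_ne_bot (sum_ne_bot fun j _ => h j)

theorem exists_real_of_sum_le [Fintype ι] {f : ι → EReal} (h : ∀ i, f i ≠ ⊥) {a : ℝ}
    (ha : ∑ i, f i ≤ a) : ∃ r : ι → ℝ, ∀ i, f i = r i := by
  refine ⟨fun i => (f i).toReal, fun i => (EReal.coe_toReal (fun hi => ?_) (h i)).symm⟩
  rw [sum_eq_top h hi] at ha
  exact EReal.coe_ne_top a (top_le_iff.1 ha)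

theorem sum_toENNReal_sub_coe (s : Finset ι) (f : ι → EReal) (a : ι → ℝ)
    (h : ∀ i ∈ s, (a i : EReal) ≤ f i) :
    ∑ i ∈ s, (f i - a i).toENNReal = (∑ i ∈ s, f i - (∑ i ∈ s, a i : ℝ)).toENNReal := by
  classical
  have hsub {x : EReal} {r : ℝ} (hx : (r : EReal) ≤ x) : 0 ≤ x - r :=
    (EReal.sub_nonneg (.inr (EReal.coe_ne_top _)) (.inr (EReal.coe_ne_bot _))).2 hx
  induction s using Finset.induction_on with
  | empty => simp
  | insert i s hi ih =>
    rw [Finset.sum_insert hi, Finset.sum_insert hi, Finset.sum_insert hi,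
      ih fun j hj => h j (by simp [hj]), ← EReal.toENNReal_add (hsub (h i (by simp))) (hsub ?_),
      EReal.coe_add, EReal.add_sub_add_comm (.inl (EReal.coe_ne_bot _)) (.inl (EReal.coe_ne_top _))]
    rw [coe_finset_sum]
    exact Finset.sum_le_sum fun j hj => h j (by simp [hj])

end ExtendedReals

/-! ### Bounds and wedge identities for the determinant -/

section Determinant

variable {d : ℕ}

theorem continuous_detVec : Continuous (detVec : (Fin d → E d) → ℝ) := by
  unfold detVec
  refine Continuous.matrix_det (continuous_matrix fun i j => ?_)
  simp only [Matrix.of_apply]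
  fun_prop

/-- The Leibniz expansion suffices: the bound only serves integrability, so Hadamard's sharp
constant is not needed. -/
theorem abs_detVec_le (x : Fin d → E d) : |detVec x| ≤ d.factorial * ∏ i, ‖x i‖ := by
  unfold detVec
  rw [Matrix.det_apply]
  refine (Finset.abs_sum_le_sum_abs _ _).trans ?_
  have h (σ : Equiv.Perm (Fin d)) :
      |Equiv.Perm.sign σ • ∏ i, (Matrix.of fun k i => x i k) (σ i) i| ≤ ∏ i, ‖x i‖ := by
    have h1 : |Equiv.Perm.sign σ • ∏ i, (Matrix.of fun k i => x i k) (σ i) i| =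
        ∏ i, |x i (σ i)| := by
      rcases Int.units_eq_one_or (Equiv.Perm.sign σ) with hσ | hσ <;>
        simp [hσ, Finset.abs_prod]
    rw [h1]
    exact Finset.prod_le_prod (fun i _ => abs_nonneg _) fun i _ => PiLp.norm_apply_le (x i) (σ i)
  refine (Finset.sum_le_sum fun σ _ => h σ).trans ?_
  simp [Fintype.card_perm]

theorem signedWedge_congr {n : ℕ} {i : Fin (n + 1)} {x y : Fin (n + 1) → E (n + 1)}
    (h : ∀ j, j ≠ i → x j = y j) : signedWedge i x = signedWedge i y := by
  unfold signedWedge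
  congr 2
  ext1 j
  exact h _ (Fin.succAbove_ne i j)

theorem inner_signedWedge_update {n : ℕ} (i : Fin (n + 1)) (x : Fin (n + 1) → E (n + 1))
    (z : E (n + 1)) : inner ℝ z (signedWedge i x) = detVec (Function.update x i z) := by
  rw [← inner_signedWedge i, Function.update_self,
    signedWedge_congr (x := Function.update x i z) (y := x) fun j hj => by simp [hj]]

end Determinant

/-! ### Integrability from the moment condition -/

section Integrability

variable {d : ℕ} {μ : Fin d → Measure (E d)}

theorem measurable_coord (i : Fin d) : Measurable fun x : Fin d → E d => x i :=
  measurable_pi_apply i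

theorem MomentCondition.exists_integrable (hμ : MomentCondition μ) :
    ∃ p : Fin d → ℝ, (∀ i, 1 < p i) ∧ ∑ i, 1 / p i = 1 ∧
      ∀ i, Integrable (fun x => ‖x‖ ^ p i / p i) (μ i) := by
  obtain ⟨p, hp, hsum, hfin⟩ := hμ
  refine ⟨p, hp, hsum, fun i => ⟨?_, ?_⟩⟩
  · have : Measurable fun x : E d => ‖x‖ ^ p i / p i :=
      (measurable_norm.pow_const _).div_const _
    exact this.aestronglyMeasurable
  · have h0 (x : E d) : 0 ≤ ‖x‖ ^ p i / p i :=
      div_nonneg (Real.rpow_nonneg (norm_nonneg _) _) (by linarith [hp i])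
    rw [hasFiniteIntegral_iff_ofReal (.of_forall h0)]
    exact ENNReal.sum_lt_top.1 hfin i (Finset.mem_univ i)

theorem MomentCondition.integrable_norm (hμ : MomentCondition μ)
    (hprob : ∀ i, IsProbabilityMeasure (μ i)) (i : Fin d) : Integrable (fun x => ‖x‖) (μ i) := by
  obtain ⟨p, hp, -, hint⟩ := hμ.exists_integrable
  have := hprob i
  refine ((integrable_const (1 : ℝ)).add ((hint i).const_mul (p i))).mono'
    measurable_norm.aestronglyMeasurable (.of_forall fun x => ?_)
  have hp0 : p i ≠ 0 := by linarith [hp i]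
  simp only [Pi.add_apply, norm_norm]
  rw [mul_div_cancel₀ _ hp0]
  rcases le_total ‖x‖ 1 with h | h
  · linarith [Real.rpow_nonneg (norm_nonneg x) (p i)]
  · linarith [Real.self_le_rpow_of_one_le h (hp i).le]

theorem integrable_coord {γ : Measure (Fin d → E d)} (hγ : γ ∈ couplings μ) {i : Fin d}
    {f : E d → ℝ} (hf : Integrable f (μ i)) : Integrable (fun x => f (x i)) γ := by
  rw [← hγ.2 i] at hf
  exact hf.comp_measurable (measurable_coord i)

theorem integral_coord {γ : Measure (Fin d → E d)} (hγ : γ ∈ couplings μ) {i : Fin d}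
    {f : E d → ℝ} (hf : Integrable f (μ i)) : ∫ x, f (x i) ∂γ = ∫ z, f z ∂μ i := by
  rw [← hγ.2 i] at hf ⊢
  exact (integral_map (measurable_coord i).aemeasurable hf.1).symm

/-- Weighted AM–GM with weights `1 / p i` bounds `∏ ‖x i‖` by `∑ ‖x i‖ ^ p i / p i`, a sum of
functions of one coordinate. -/
theorem MomentCondition.integrable_detVec (hμ : MomentCondition μ) {γ : Measure (Fin d → E d)}
    (hγ : γ ∈ couplings μ) : Integrable detVec γ := by
  obtain ⟨p, hp, hsum, hint⟩ := hμ.exists_integrable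
  refine ((integrable_finsetSum Finset.univ fun i _ =>
    integrable_coord hγ (hint i)).const_mul (d.factorial : ℝ)).mono'
    continuous_detVec.aestronglyMeasurable (.of_forall fun x => ?_)
  refine (abs_detVec_le x).trans (mul_le_mul_of_nonneg_left ?_ (Nat.cast_nonneg _))
  have hp0 (i) : 0 < p i := by linarith [hp i]
  have h := Real.geom_mean_le_arith_mean_weighted Finset.univ (fun i => 1 / p i)
    (fun i => ‖x i‖ ^ p i) (fun i _ => (one_div_pos.2 (hp0 i)).le) hsum
    fun i _ => Real.rpow_nonneg (norm_nonneg _) _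
  have hl (i) : (‖x i‖ ^ p i) ^ (1 / p i) = ‖x i‖ := by
    rw [one_div, Real.rpow_rpow_inv (norm_nonneg _) (hp0 i).ne']
  have hr (i) : 1 / p i * ‖x i‖ ^ p i = ‖x i‖ ^ p i / p i := by ring
  simpa only [hl, hr] using h

end Integrability

/-! ### Legendre–Fenchel conjugates and subgradients -/

section Conjugate

variable {d : ℕ}

theorem lowerSemicontinuous_conj (f : E d → EReal) : LowerSemicontinuous (conj f) := by
  unfold conj
  refine lowerSemicontinuous_iSup fun z => ?_
  generalize f z = a
  have h : Continuous fun y : E d => inner ℝ z y := by fun_prop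
  induction a using EReal.rec with
  | bot => simpa using lowerSemicontinuous_const
  | top => simpa using lowerSemicontinuous_const
  | coe r =>
    simp_rw [← EReal.coe_sub]
    exact (continuous_coe_real_ereal.comp (h.sub continuous_const)).lowerSemicontinuous

theorem convexE_conj (f : E d → EReal) : ConvexE (conj f) := by
  intro x y a b ha hb hab
  have hle (w z : E d) : ((inner ℝ z w : ℝ) : EReal) - f z ≤ conj f w :=
    le_iSup (fun z => ((inner ℝ z w : ℝ) : EReal) - f z) z
  refine iSup_le fun z => ?_
  have ha' : (0 : EReal) ≤ a := EReal.coe_nonneg.2 ha.le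
  have hb' : (0 : EReal) ≤ b := EReal.coe_nonneg.2 hb.le
  refine le_trans ?_ (add_le_add (mul_le_mul_of_nonneg_left (hle x z) ha')
    (mul_le_mul_of_nonneg_left (hle y z) hb'))
  generalize f z = r
  induction r using EReal.rec with
  | bot => simp [EReal.coe_mul_top_of_pos ha, EReal.coe_mul_top_of_pos hb]
  | top => simp
  | coe r =>
    rw [inner_add_right, inner_smul_right, inner_smul_right]
    norm_cast
    have : r = a * r + b * r := by rw [← add_mul, hab, one_mul]
    linarith

theorem inner_sub_conj_le {f : E d → EReal} (x y : E d) (hf : f x ≠ ⊥) :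
    ((inner ℝ x y : ℝ) : EReal) - conj f y ≤ f x := by
  rcases eq_or_ne (f x) ⊤ with h1 | h1
  · rw [h1]; exact le_top
  · refine EReal.sub_le_of_le_add' ?_
    rw [← EReal.sub_le_iff_le_add (.inl hf) (.inl h1)]
    exact le_iSup (fun z => ((inner ℝ z y : ℝ) : EReal) - f z) x

theorem conj_conj_le {f : E d → EReal} (hf : ∀ x, f x ≠ ⊥) (x : E d) : conj (conj f) x ≤ f x :=
  iSup_le fun y => by
    rw [real_inner_comm]
    exact inner_sub_conj_le x y (hf x)

theorem conj_le_of_mem_subdiff {f : E d → EReal} {x y : E d} {r : ℝ} (hx : f x = r)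
    (hy : y ∈ subdiff f x) : conj f y ≤ ((inner ℝ x y - r : ℝ) : EReal) := by
  refine iSup_le fun z => EReal.sub_le_of_le_add' ?_
  have := hy z
  rw [hx, ← EReal.coe_add] at this
  refine le_trans ?_ (add_le_add_left this _)
  rw [← EReal.coe_add, EReal.coe_le_coe_iff, inner_sub_right, real_inner_comm y z,
    real_inner_comm y x]
  linarith

end Conjugate

/-! ### Potentials, optimality and convexification -/

section Duality

variable {n : ℕ} {φ : Fin (n + 1) → E (n + 1) → EReal}

/-- Move `φ i (x i)` across and take the supremum over `x i`, on which the wedge does not depend. -/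
theorem forall_conj_le_iff (hφ : ∀ i z, φ i z ≠ ⊥) (i : Fin (n + 1)) :
    (∀ x : Fin (n + 1) → E (n + 1),
      conj (φ i) (signedWedge i x) ≤ ∑ j ∈ Finset.univ.erase i, φ j (x j)) ↔
    ∀ x : Fin (n + 1) → E (n + 1), (detVec x : EReal) ≤ ∑ j, φ j (x j) := by
  constructor
  · intro h x
    rw [← Finset.add_sum_erase _ _ (Finset.mem_univ i), add_comm (φ i (x i)),
      ← EReal.sub_le_iff_le_add (.inl (hφ _ _)) (.inr (sum_ne_bot fun j _ => hφ _ _))]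
    refine le_trans ?_ (h x)
    rw [← inner_signedWedge i x]
    exact le_iSup (fun z => ((inner ℝ z (signedWedge i x) : ℝ) : EReal) - φ i z) (x i)
  · intro h x
    refine iSup_le fun z => EReal.sub_le_of_le_add' ?_
    rw [inner_signedWedge_update]
    refine (h _).trans_eq ?_
    rw [← Finset.add_sum_erase _ _ (Finset.mem_univ i), Function.update_self]
    congr 1
    exact Finset.sum_congr rfl fun j hj => by
      rw [Function.update_of_ne (Finset.ne_of_mem_erase hj)]

/-- At a point where the conjugacy and subdifferential conditions hold, the potentials are finite
and their sum is at most the determinant. -/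
theorem exists_real_of_mem_subdiff (hφ : ∀ i z, φ i z ≠ ⊥) {x : Fin (n + 1) → E (n + 1)}
    (hx : ∀ i, ∑ j ∈ Finset.univ.erase i, φ j (x j) = conj (φ i) (signedWedge i x))
    (hs : ∀ i, signedWedge i x ∈ subdiff (φ i) (x i)) :
    ∃ r : Fin (n + 1) → ℝ, (∀ i, φ i (x i) = r i) ∧ ∑ i, φ i (x i) ≤ detVec x := by
  -- A subgradient where `φ i` is `⊤` forces `φ i` to be identically `⊤`; its conjugate is then `⊥`,
  -- which the sum in `hx` cannot be.
  have htop (i) : φ i (x i) ≠ ⊤ := by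
    intro hi
    have h1 (z) : φ i z = ⊤ := by
      have := hs i z
      rwa [hi, EReal.top_add_coe, top_le_iff] at this
    refine sum_ne_bot (s := Finset.univ.erase i) (f := fun j => φ j (x j)) (fun j _ => hφ _ _) ?_
    rw [hx i]
    simp [conj, h1]
  refine ⟨fun i => (φ i (x i)).toReal,
    fun i => (EReal.coe_toReal (htop i) (hφ _ _)).symm, ?_⟩
  have h2 := conj_le_of_mem_subdiff (EReal.coe_toReal (htop 0) (hφ 0 _)).symm (hs 0)
  rw [← hx 0, inner_signedWedge] at h2
  rw [← Finset.add_sum_erase _ _ (Finset.mem_univ 0)]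
  refine (add_le_add_right h2 _).trans_eq ?_
  nth_rw 1 [← EReal.coe_toReal (htop 0) (hφ 0 _)]
  rw [← EReal.coe_add]
  congr 1
  ring

/-- The integrals of `∑ F i` and of `∑ a i` depend only on the marginals. The first, possibly
infinite a priori, is a lower integral of nonnegative functions; equality along γ shows that it is
finite. -/
theorem solvesMK_of_potential {μ : Fin (n + 1) → Measure (E (n + 1))}
    (hprob : ∀ i, IsProbabilityMeasure (μ i)) (hμ : MomentCondition μ)
    {γ : Measure (Fin (n + 1) → E (n + 1))} (hγ : γ ∈ couplings μ)
    (hφ : ∀ i, Measurable (φ i))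
    (haff : ∀ i, ∃ (w : E (n + 1)) (b : ℝ), ∀ z, ((inner ℝ w z + b : ℝ) : EReal) ≤ φ i z)
    (hle : ∀ x : Fin (n + 1) → E (n + 1), (detVec x : EReal) ≤ ∑ j, φ j (x j))
    (hge : ∀ᵐ x ∂γ, ∑ j, φ j (x j) ≤ detVec x) : SolvesMK μ γ := by
  refine ⟨hγ, fun γ' hγ' => ?_⟩
  choose w b hwb using haff
  set a : Fin (n + 1) → E (n + 1) → ℝ := fun i z => inner ℝ (w i) z + b i with ha
  set F : Fin (n + 1) → E (n + 1) → ENNReal := fun i z => (φ i z - a i z).toENNReal with hF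
  have haint (i) : Integrable (a i) (μ i) := by
    have := hprob i
    refine Integrable.add ?_ (integrable_const _)
    refine ((hμ.integrable_norm hprob i).const_mul ‖w i‖).mono' ?_
      (.of_forall fun z => norm_inner_le_norm _ _)
    exact (by fun_prop : Continuous fun z => inner ℝ (w i) z).aestronglyMeasurable
  have hacont (i) : Measurable (a i) :=
    (by fun_prop : Continuous fun z => inner ℝ (w i) z + b i).measurable
  have hFm (i) : Measurable (F i) := by
    refine Measurable.ereal_toENNReal ?_
    simp only [sub_eq_add_neg]
    exact (hφ i).add (measurable_coe_real_ereal.comp (hacont i)).neg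
  have hFsum (x : Fin (n + 1) → E (n + 1)) :
      ∑ i, F i (x i) = (∑ i, φ i (x i) - (∑ i, a i (x i) : ℝ)).toENNReal :=
    sum_toENNReal_sub_coe _ (fun i => φ i (x i)) (fun i => a i (x i)) fun i _ => hwb i (x i)
  set D : (Fin (n + 1) → E (n + 1)) → ℝ := fun x => detVec x - ∑ i, a i (x i) with hD
  have hDF (x) : ENNReal.ofReal (D x) ≤ ∑ i, F i (x i) := by
    rw [hFsum, ← EReal.real_coe_toENNReal]
    refine EReal.toENNReal_le_toENNReal ?_
    rw [hD, EReal.coe_sub]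
    exact EReal.sub_le_sub (hle x) le_rfl
  have hFD : ∀ᵐ x ∂γ, ∑ i, F i (x i) = ENNReal.ofReal (D x) ∧ 0 ≤ D x := by
    filter_upwards [hge] with x hx
    have hx' := le_antisymm hx (hle x)
    refine ⟨by rw [hFsum, hx', ← EReal.coe_sub, EReal.real_coe_toENNReal], sub_nonneg.2 ?_⟩
    rw [← EReal.coe_le_coe_iff, ← hx', coe_finset_sum]
    exact Finset.sum_le_sum fun i _ => hwb i (x i)
  have hlint {ρ} (hρ : ρ ∈ couplings μ) :
      ∫⁻ x, ∑ i, F i (x i) ∂ρ = ∑ i, ∫⁻ z, F i z ∂μ i := by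
    have hm (i) : Measurable fun x : Fin (n + 1) → E (n + 1) => F i (x i) :=
      (hFm i).comp (measurable_coord i)
    rw [lintegral_finsetSum _ fun i _ => hm i]
    refine Finset.sum_congr rfl fun i _ => ?_
    rw [← hρ.2 i, lintegral_map (hFm i) (measurable_coord i)]
  have hAint {ρ} (hρ : ρ ∈ couplings μ) : Integrable (fun x => ∑ i, a i (x i)) ρ :=
    integrable_finsetSum _ fun i _ => integrable_coord hρ (haint i)
  have hDint {ρ} (hρ : ρ ∈ couplings μ) : Integrable D ρ :=
    (hμ.integrable_detVec hρ).sub (hAint hρ)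
  have hA {ρ} (hρ : ρ ∈ couplings μ) :
      ∫ x, D x ∂ρ = ∫ x, detVec x ∂ρ - ∑ i, ∫ z, a i z ∂μ i := by
    rw [hD, integral_sub (hμ.integrable_detVec hρ) (hAint hρ),
      integral_finsetSum _ fun i _ => integrable_coord hρ (haint i)]
    simp_rw [integral_coord hρ (haint _)]
  have hγF : ENNReal.ofReal (∫ x, D x ∂γ) = ∑ i, ∫⁻ z, F i z ∂μ i := by
    rw [ofReal_integral_eq_lintegral_ofReal (hDint hγ) (hFD.mono fun x hx => hx.2), ← hlint hγ]
    exact lintegral_congr_ae (hFD.mono fun x hx => hx.1.symm)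
  have hγ0 : 0 ≤ ∫ x, D x ∂γ := integral_nonneg_of_ae (hFD.mono fun x hx => hx.2)
  have key : ∫ x, D x ∂γ' ≤ ∫ x, D x ∂γ := by
    have h1 : ∫ x, D x ∂γ' ≤ (∫⁻ x, ENNReal.ofReal (D x) ∂γ').toReal := by
      rw [integral_eq_lintegral_pos_part_sub_lintegral_neg_part (hDint hγ')]
      exact sub_le_self _ ENNReal.toReal_nonneg
    have h2 : ∫⁻ x, ENNReal.ofReal (D x) ∂γ' ≤ ENNReal.ofReal (∫ x, D x ∂γ) := by
      rw [hγF, ← hlint hγ']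
      exact lintegral_mono hDF
    exact h1.trans (ENNReal.toReal_le_of_le_ofReal hγ0 h2)
  rw [hA hγ, hA hγ'] at key
  change ∫ x, detVec x ∂γ' ≤ ∫ x, detVec x ∂γ
  linarith

/-- Test the supremum defining the biconjugate at `signedWedge i x`, where the conjugate is at most
the sum of the other potentials. -/
theorem detVec_le_sum_update_conj_conj (hφ : ∀ i z, φ i z ≠ ⊥)
    (h : ∀ x : Fin (n + 1) → E (n + 1), (detVec x : EReal) ≤ ∑ j, φ j (x j)) (i : Fin (n + 1))
    (hi : ∀ z, conj (conj (φ i)) z ≠ ⊥) (x : Fin (n + 1) → E (n + 1)) :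
    (detVec x : EReal) ≤ ∑ j, Function.update φ i (conj (conj (φ i))) j (x j) := by
  have h1 := (forall_conj_le_iff hφ i).2 h x
  rw [← Finset.add_sum_erase _ _ (Finset.mem_univ i), Function.update_self,
    Finset.sum_congr rfl fun j hj => by
      rw [Function.update_of_ne (Finset.ne_of_mem_erase hj)],
    ← EReal.sub_le_iff_le_add (.inl (sum_ne_bot fun j _ => hφ _ _)) (.inr (hi _))]
  refine (EReal.sub_le_sub le_rfl h1).trans ?_
  rw [← inner_signedWedge i x, real_inner_comm]
  exact le_iSup (fun y => ((inner ℝ y (x i) : ℝ) : EReal) - conj (φ i) y) (signedWedge i x)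

/-- Biconjugates are substituted one index at a time, each substitution using the inequality already
improved by the previous ones. -/
theorem detVec_le_sum_conj_conj (hφ : ∀ i z, φ i z ≠ ⊥)
    (h : ∀ x : Fin (n + 1) → E (n + 1), (detVec x : EReal) ≤ ∑ j, φ j (x j))
    (hi : ∀ i z, conj (conj (φ i)) z ≠ ⊥) (x : Fin (n + 1) → E (n + 1)) :
    (detVec x : EReal) ≤ ∑ j, conj (conj (φ j)) (x j) := by
  have key (S : Finset (Fin (n + 1))) : ∀ x : Fin (n + 1) → E (n + 1),
      (detVec x : EReal) ≤ ∑ j, (if j ∈ S then conj (conj (φ j)) else φ j) (x j) := by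
    induction S using Finset.induction_on with
    | empty => simpa using h
    | insert i S hiS ih =>
      intro x
      have h2 := detVec_le_sum_update_conj_conj
        (φ := fun j => if j ∈ S then conj (conj (φ j)) else φ j)
        (fun j z => by split_ifs; exacts [hi j z, hφ j z]) ih i
        (by simpa [hiS] using hi i) x
      refine h2.trans_eq (Finset.sum_congr rfl fun j _ => ?_)
      rcases eq_or_ne j i with rfl | hj
      · simp [hiS]
      · simp [hj]
  simpa using key Finset.univ x

theorem conj_conj_ne_bot {d : ℕ} {f : E d → EReal} {y : E d} (hy : conj f y ≠ ⊤) (z : E d) :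
    conj (conj f) z ≠ ⊥ := by
  refine ne_bot_of_le_ne_bot ?_
    (le_iSup (fun y => ((inner ℝ y z : ℝ) : EReal) - conj f y) y)
  rw [sub_eq_add_neg, EReal.add_ne_bot_iff]
  exact ⟨EReal.coe_ne_bot _, fun h => hy (EReal.neg_eq_bot_iff.1 h)⟩

theorem SolvesMK.exists_potential {μ : Fin (n + 1) → Measure (E (n + 1))}
    (hμ : MomentCondition μ) {γ : Measure (Fin (n + 1) → E (n + 1))} (h : SolvesMK μ γ) :
    ∃ ψ : Fin (n + 1) → γ.support → ℝ,
      (∀ s : Fin (n + 1) → γ.support, detVec (fun i => (s i).1 i) ≤ ∑ i, ψ i (s i)) ∧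
      ∀ k : γ.support, ∑ i, ψ i k = detVec k.1 := by
  classical
  obtain ⟨hγ, hmax⟩ := h
  have := hγ.1
  have hopt (γ' : Measure (Fin (n + 1) → E (n + 1)))
      (hγ' : ∀ i, γ'.map (fun x => x i) = γ.map fun x => x i) :
      ∫ x, detVec x ∂γ' ≤ ∫ x, detVec x ∂γ := by
    refine hmax ⟨⟨?_⟩, fun i => (hγ' i).trans (hγ.2 i)⟩
    have h3 := congrArg (fun ρ => ρ Set.univ) (hγ' 0)
    simpa only [Measure.map_apply (measurable_coord _) MeasurableSet.univ, Set.preimage_univ,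
      measure_univ] using h3
  -- The potentials are indexed by whole points of the support, not by their coordinates.
  refine exists_potential_of_finite (fun s : Fin (n + 1) → γ.support =>
    detVec fun i => (s i).1 i) fun G ε hε => ?_
  obtain ⟨φ, h1, h2⟩ := exists_potential_lt_add
    (fun s : Fin (n + 1) → G => detVec fun i => (s i).1.1 i)
    (fun α β hα hβ hαβ => sum_mul_le_of_mem_support continuous_detVec (hμ.integrable_detVec hγ)
      hopt (fun k : G => k.1.1) (fun k => k.1.2) α β hα hβ hαβ) hε
  refine ⟨fun i k => if hk : k ∈ G then φ i ⟨k, hk⟩ else 0, fun s hs => ?_, fun k hk => ?_⟩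
  · simpa [hs] using (h1 fun i => ⟨s i, hs i⟩).le
  · simpa [hk] using (h2 ⟨k, hk⟩).le

theorem SolvesMK.exists_convex_potential {μ : Fin (n + 1) → Measure (E (n + 1))}
    (hμ : MomentCondition μ) {γ : Measure (Fin (n + 1) → E (n + 1))} (h : SolvesMK μ γ) :
    ∃ φ : Fin (n + 1) → E (n + 1) → EReal,
      (∀ i, (∀ x, φ i x ≠ ⊥) ∧ LowerSemicontinuous (φ i) ∧ ConvexE (φ i)) ∧
      (∀ x : Fin (n + 1) → E (n + 1), (detVec x : EReal) ≤ ∑ j, φ j (x j)) ∧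
      ∀ᵐ x ∂γ, ∑ j, φ j (x j) ≤ detVec x := by
  classical
  obtain ⟨ψ, hψ, hψeq⟩ := h.exists_potential hμ
  have := h.1.1
  -- Replacing `k` by `l` in slot `i` leaves the determinant unchanged when the `i`-th coordinates
  -- agree. By symmetry `ψ i` depends only on that coordinate, so the choice made in `f` is
  -- harmless.
  have hmono (i) (k l : γ.support) (hkl : k.1 i = l.1 i) : ψ i k ≤ ψ i l := by
    have h1 := hψ (Function.update (fun _ => k) i l)
    have h2 : (fun j => (Function.update (fun _ => k) i l j).1 j) = k.1 := by
      ext1 j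
      rcases eq_or_ne j i with rfl | hj
      · simp [hkl]
      · simp [hj]
    have h3 : ∑ j ∈ Finset.univ.erase i, ψ j (Function.update (fun _ => k) i l j) =
        ∑ j ∈ Finset.univ.erase i, ψ j k := Finset.sum_congr rfl fun j hj => by
      rw [Function.update_of_ne (Finset.ne_of_mem_erase hj)]
    rw [h2, ← hψeq, ← Finset.add_sum_erase _ _ (Finset.mem_univ i),
      ← Finset.add_sum_erase _ (fun j => ψ j (Function.update (fun _ => k) i l j))
        (Finset.mem_univ i), Function.update_self, h3] at h1
    linarith
  let f : Fin (n + 1) → E (n + 1) → EReal := fun i z =>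
    if hz : ∃ k : γ.support, k.1 i = z then (ψ i hz.choose : EReal) else ⊤
  have hf_bot (i z) : f i z ≠ ⊥ := by
    simp only [f]
    split_ifs
    · exact EReal.coe_ne_bot _
    · exact top_ne_bot
  have hf_le (x : Fin (n + 1) → E (n + 1)) : (detVec x : EReal) ≤ ∑ j, f j (x j) := by
    by_cases hx : ∀ i, ∃ k : γ.support, k.1 i = x i
    · have h1 := hψ fun i => (hx i).choose
      have h2 : (fun i => (hx i).choose.1 i) = x := funext fun i => (hx i).choose_spec
      rw [h2, ← EReal.coe_le_coe_iff, coe_finset_sum] at h1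
      refine h1.trans_eq (Finset.sum_congr rfl fun i _ => ?_)
      simp only [f, dif_pos (hx i)]
    · obtain ⟨i, hi⟩ := not_forall.1 hx
      rw [sum_eq_top (fun j => hf_bot j (x j)) (i := i) (by simp only [f, dif_neg hi])]
      exact le_top
  have hf_ge (k : γ.support) : ∑ j, f j (k.1 j) ≤ detVec k.1 := by
    rw [← hψeq, coe_finset_sum]
    refine Finset.sum_le_sum fun i _ => ?_
    have hk : ∃ l : γ.support, l.1 i = k.1 i := ⟨k, rfl⟩
    simp only [f, dif_pos hk]
    exact EReal.coe_le_coe_iff.2 (hmono i _ _ hk.choose_spec)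
  obtain ⟨k⟩ : Nonempty γ.support :=
    (Measure.nonempty_support (IsProbabilityMeasure.ne_zero γ)).to_subtype
  have hbot (i z) : conj (conj (f i)) z ≠ ⊥ := by
    refine conj_conj_ne_bot (y := signedWedge i k.1) (ne_top_of_le_ne_top ?_
      ((forall_conj_le_iff hf_bot i).2 hf_le k.1)) z
    obtain ⟨r, hr⟩ := exists_real_of_sum_le (fun j => hf_bot j (k.1 j)) (hf_ge k)
    exact sum_ne_top fun j _ => by rw [hr]; exact EReal.coe_ne_top _
  refine ⟨fun i => conj (conj (f i)), fun i => ⟨hbot i, lowerSemicontinuous_conj _,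
    convexE_conj _⟩, detVec_le_sum_conj_conj hf_bot hf_le hbot, ?_⟩
  -- Biconjugation only lowers the potentials, so the upper bound on the support survives.
  filter_upwards [Measure.support_mem_ae (μ := γ)] with x hx
  exact (Finset.sum_le_sum fun j _ => conj_conj_le (hf_bot j) (x j)).trans (hf_ge ⟨x, hx⟩)

/-- Where the sum of the potentials attains the determinant, the wedge products lie in the
subdifferentials. -/
theorem eq_conj_and_mem_subdiff (hφ : ∀ i z, φ i z ≠ ⊥)
    (hle : ∀ x : Fin (n + 1) → E (n + 1), (detVec x : EReal) ≤ ∑ j, φ j (x j))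
    {x : Fin (n + 1) → E (n + 1)} (hx : ∑ j, φ j (x j) ≤ detVec x) (i : Fin (n + 1)) :
    ∑ j ∈ Finset.univ.erase i, φ j (x j) = conj (φ i) (signedWedge i x) ∧
      signedWedge i x ∈ subdiff (φ i) (x i) := by
  have hc := (forall_conj_le_iff hφ i).2 hle x
  obtain ⟨r, hr⟩ := exists_real_of_sum_le (fun j => hφ j (x j)) hx
  simp only [hr] at hx hc ⊢
  rw [← coe_finset_sum] at hx hc ⊢
  rw [EReal.coe_le_coe_iff, ← Finset.add_sum_erase _ _ (Finset.mem_univ i)] at hx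
  set s := ∑ j ∈ Finset.univ.erase i, r j
  constructor
  · refine le_antisymm ?_ hc
    refine le_trans ?_ (le_iSup (fun z => ((inner ℝ z (signedWedge i x) : ℝ) : EReal) - φ i z) (x i))
    rw [hr, inner_signedWedge, ← EReal.coe_sub, EReal.coe_le_coe_iff]
    linarith
  · intro z
    have h1 := (le_iSup (fun z => ((inner ℝ z (signedWedge i x) : ℝ) : EReal) - φ i z) z).trans hc
    rw [EReal.sub_le_iff_le_add (.inl (hφ _ _)) (.inr (EReal.coe_ne_bot _)), add_comm (s : EReal)] at h1
    have h2 := EReal.sub_le_of_le_add h1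
    refine le_trans ?_ h2
    rw [hr, ← EReal.coe_add, ← EReal.coe_sub, EReal.coe_le_coe_iff, inner_sub_right,
      real_inner_comm z, real_inner_comm (x i), inner_signedWedge]
    linarith

end Duality

end DetTransport

end

open DetTransport in
theorem mainTheorem4 (n : ℕ) (μ : Fin (n + 1) → Measure (E (n + 1)))
    (hprob : ∀ i, IsProbabilityMeasure (μ i)) (hμ : MomentCondition μ)
    (γ : Measure (Fin (n + 1) → E (n + 1))) (hγ : γ ∈ couplings μ) :
    SolvesMK μ γ ↔
      ∃ φ : Fin (n + 1) → E (n + 1) → EReal,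
        (∀ i, (∀ x, φ i x ≠ ⊥) ∧ LowerSemicontinuous (φ i) ∧ ConvexE (φ i)) ∧
        ∀ i,
          (∀ x : Fin (n + 1) → E (n + 1),
            conj (φ i) (signedWedge i x) ≤ ∑ j ∈ Finset.univ.erase i, φ j (x j)) ∧
          (∀ᵐ x ∂γ, ∑ j ∈ Finset.univ.erase i, φ j (x j) = conj (φ i) (signedWedge i x)) ∧
          (∀ᵐ x ∂γ, signedWedge i x ∈ subdiff (φ i) (x i)) := by
  constructor
  · intro h
    obtain ⟨φ, hφ, hle, hge⟩ := h.exists_convex_potential hμ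
    have hbot (i z) : φ i z ≠ ⊥ := (hφ i).1 z
    exact ⟨φ, hφ, fun i => ⟨(forall_conj_le_iff hbot i).2 hle,
      hge.mono fun x hx => (eq_conj_and_mem_subdiff hbot hle hx i).1,
      hge.mono fun x hx => (eq_conj_and_mem_subdiff hbot hle hx i).2⟩⟩
  · rintro ⟨φ, hφ, h⟩
    have hbot (i z) : φ i z ≠ ⊥ := (hφ i).1 z
    have hae : ∀ᵐ x ∂γ, ∀ i,
        ∑ j ∈ Finset.univ.erase i, φ j (x j) = conj (φ i) (signedWedge i x) ∧
          signedWedge i x ∈ subdiff (φ i) (x i) :=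
      ae_all_iff.2 fun i => (h i).2.1.and (h i).2.2
    have := hγ.1
    obtain ⟨x₀, hx₀⟩ := hae.exists
    obtain ⟨r, hr, -⟩ := exists_real_of_mem_subdiff hbot (fun i => (hx₀ i).1) fun i => (hx₀ i).2
    refine solvesMK_of_potential hprob hμ hγ (fun i => (hφ i).2.1.measurable) (fun i => ?_)
      ((forall_conj_le_iff hbot 0).1 (h 0).1) (hae.mono fun x hx => ?_)
    -- The subgradient at the single good point `x₀` is the slope of an affine minorant of `φ i`.
    · refine ⟨signedWedge i x₀, r i - inner ℝ (signedWedge i x₀) (x₀ i), fun z => ?_⟩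
      refine le_trans (le_of_eq ?_) ((hx₀ i).2 z)
      rw [hr, ← EReal.coe_add, inner_sub_right]
      congr 1
      ring
    · obtain ⟨-, -, hx'⟩ := exists_real_of_mem_subdiff hbot (fun i => (hx i).1) fun i => (hx i).2
      exact hx'
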